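/- Let $k$ be a field, let $G$ be a nilpotent group, and let $M$ be a finite-dimensional $k$-vector space that is a $G$-bimodule: $G$ acts $k$-linearly on $M$ on the left, $m\mapsto g\cdot m$, and on the right, $m\mapsto m\cdot g$, and the two actions commute, $g\cdot(m\cdot h)=(g\cdot m)\cdot h$ for all $g,h\in G$ and $m\in M$. Let $HH^n(G,M)$, $n\ge 0$, denote the Hochschild cohomology of this bimodule, i.e. the $n$-th cohomology of the complex with $C^n(G,M)=\{\text{all functions } f:G^n\to M\}$ and $$(\delta f)(g_0,\dots,g_n)=g_0\cdot f(g_1,\dots,g_n)+\sum_{j=0}^{n-1}(-1)^{j+1}f(g_0,\dots,g_jg_{j+1},\dots,g_n)+(-1)^{n+1}f(g_0,\dots,g_{n-1})\cdot g_n .$$ Suppose that for every $g\in G$ the linear map $m\mapsto m\cdot g$ is unipotent (that is, $m\mapsto m\cdot g-m$ is nilpotent), and that the zero vector is the only vector of $M$ that is invariant under the left action (if $g\cdot m=m$ for all $g\in G$, then $m=0$). Then $HH^n(G,M)=0$ for all $n\ge 0$. -/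

import Mathlib

open CategoryTheory MulOpposite

/-- A bimodule structure over the group `G` on the `k`-module `M`: a `k`-linear left action
`m ↦ left g m` and a `k`-linear right action `m ↦ right (op g) m` (written `m · g`), which
commute: `g · (m · h) = (g · m) · h`. -/
structure GroupBimodule (k G M : Type*) [CommRing k] [Group G] [AddCommGroup M] [Module k M] where
  /-- The left action. -/
  left : Representation k G M
  /-- The right action, as a representation of the opposite group. -/
  right : Representation k Gᵐᵒᵖ M
  /-- The two actions commute. -/
  left_right : ∀ (g h : G) (m : M), left g (right (op h) m) = right (op h) (left g m)

namespace GroupBimodule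

section

variable {k G M : Type*} [CommRing k] [Group G] [AddCommGroup M] [Module k M]

/-- The Hochschild differential on functions `f : Gⁿ → M`:
`(δf)(g₀, …, gₙ) = g₀ · f(g₁, …, gₙ) + ∑_{j < n} (-1)^(j+1) f(g₀, …, gⱼ gⱼ₊₁, …, gₙ)
  + (-1)^(n+1) f(g₀, …, gₙ₋₁) · gₙ`. -/
def hochschildD (B : GroupBimodule k G M) (n : ℕ) :
    ((Fin n → G) → M) →ₗ[k] ((Fin (n + 1) → G) → M) where
  toFun f g :=
    B.left (g 0) (f fun i => g i.succ)
      + ∑ j : Fin n, (-1 : k) ^ ((j : ℕ) + 1) • f (Fin.contractNth j.castSucc (· * ·) g)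
      + (-1 : k) ^ (n + 1) • B.right (op (g (Fin.last n))) (f fun i => g i.castSucc)
  map_add' f f' := by
    ext g
    simp only [Pi.add_apply, map_add, smul_add, Finset.sum_add_distrib]
    abel
  map_smul' r f := by
    ext g
    simp only [Pi.smul_apply, map_smul, smul_add, Finset.smul_sum, RingHom.id_apply,
      smul_comm r]

/-- The homogeneous function on `Gⁿ⁺¹` that corresponds to a function on `Gⁿ`; it is used only to
check that the Hochschild differential squares to zero. -/
def homogenize (B : GroupBimodule k G M) (n : ℕ) (f : (Fin n → G) → M) (x : Fin (n + 1) → G) : M :=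
  B.left (x 0) (B.right (op (x (Fin.last n))⁻¹) (f fun i => (x i.castSucc)⁻¹ * x i.succ))

theorem homogenize_hochschildD (B : GroupBimodule k G M) (n : ℕ) (f : (Fin n → G) → M)
    (x : Fin (n + 2) → G) :
    B.homogenize (n + 1) (B.hochschildD n f) x =
      ∑ i : Fin (n + 2), (-1 : k) ^ (i : ℕ) • B.homogenize n f (fun j => x (i.succAbove j)) := by
  rw [Fin.sum_univ_succ, Fin.sum_univ_castSucc]
  simp only [homogenize, hochschildD, LinearMap.coe_mk, AddHom.coe_mk, map_add, map_sum, map_smul,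
    ← add_assoc]
  congr 1
  · congr 1
    · rw [← B.left_right, ← Module.End.mul_apply, ← map_mul]
      simp
    · refine Finset.sum_congr rfl fun j _ => ?_
      have h0 : (Fin.succ (Fin.castSucc j)).succAbove 0 = (0 : Fin (n + 2)) := by
        simp
      have hl : (Fin.succ (Fin.castSucc j)).succAbove (Fin.last n) = Fin.last (n + 1) := by
        rw [Fin.succAbove_of_lt_succ, Fin.succ_last]
        rw [Fin.succ_lt_succ_iff]
        exact Fin.castSucc_lt_last j
      rw [h0, hl]
      congr 5
      funext i
      rw [← Fin.inv_partialProd_mul_eq_contractNth]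
      have hx : ∀ a, x a = x 0 * Fin.partialProd (fun i : Fin (n + 1) =>
          (x i.castSucc)⁻¹ * x i.succ) a := fun a => by
        conv_lhs => rw [← Fin.partialProd_left_inv x]
        simp
      rw [hx ((Fin.succ (Fin.castSucc j)).succAbove i.castSucc),
        hx ((Fin.succ (Fin.castSucc j)).succAbove i.succ), Fin.succ_succAbove_succ]
      group
  · congr 1
    rw [← Module.End.mul_apply (B.right _) (B.right _), ← map_mul, ← op_mul]
    simp [Fin.succ_last]

theorem homogenize_injective (B : GroupBimodule k G M) (n : ℕ) :
    Function.Injective (B.homogenize n) := by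
  intro f f' h
  funext g
  have := congrFun h (Fin.partialProd g)
  simp only [homogenize, Fin.partialProd_right_inv] at this
  exact (B.right.apply_bijective _).1 ((B.left.apply_bijective _).1 this)

/-- The Hochschild differential squares to zero. -/
theorem hochschildD_comp (B : GroupBimodule k G M) (n : ℕ) :
    B.hochschildD (n + 1) ∘ₗ B.hochschildD n = 0 := by
  ext f g
  revert g
  rw [← funext_iff]
  apply B.homogenize_injective
  funext x
  simp only [LinearMap.comp_apply, homogenize_hochschildD, Finset.smul_sum, smul_smul, ← pow_add,
    ← Finset.sum_product']
  have hz : B.homogenize (n + 2) ((0 : ((Fin n → G) → M) →ₗ[k] _) f) x = 0 := by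
    simp [homogenize]
  rw [hz]
  refine Finset.sum_involution
    (fun p _ => (p.1.succAbove p.2, p.2.predAbove p.1)) ?_ ?_ ?_ ?_
  · rintro ⟨i, j⟩ -
    simp only [Fin.succAbove_succAbove_succAbove_predAbove,
      Fin.neg_one_pow_succAbove_add_predAbove]
    simp
  · rintro ⟨i, j⟩ - - h
    exact Fin.succAbove_ne i j (congrArg Prod.fst h)
  · simp
  · rintro ⟨i, j⟩ -
    simp [Fin.succAbove_succAbove_predAbove, Fin.predAbove_predAbove_succAbove]

end

universe u v w

variable {k : Type u} {G : Type v} {M : Type w} [CommRing k] [Group G] [AddCommGroup M] [Module k M]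

/-- The Hochschild cochain complex `M → Fun(G, M) → Fun(G², M) → ⋯` of a `G`-bimodule `M`. Since
the `n`-tuples of elements of `G` form a basis of the `n`-th tensor power of the group algebra
`k[G]`, it is the complex `Hom_k(k[G]^{⊗ n}, M)` of Hochschild cochains of `k[G]`. -/
noncomputable def hochschildComplex (B : GroupBimodule k G M) :
    CochainComplex (ModuleCat.{max v w} k) ℕ :=
  CochainComplex.of (fun n => ModuleCat.of k ((Fin n → G) → M))
    (fun n => ModuleCat.ofHom (B.hochschildD n)) fun n => by
      rw [← ModuleCat.ofHom_comp, B.hochschildD_comp]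
      rfl

/-- The Hochschild cohomology `HHⁿ(G, M)` of a `G`-bimodule `M`. -/
noncomputable def HH (B : GroupBimodule k G M) (n : ℕ) : ModuleCat.{max v w} k :=
  B.hochschildComplex.homology n

end GroupBimodule

/-! Homogenization identifies the Hochschild complex of `M` with the equivariant homogeneous
cochains of `G` in the adjoint representation `g · m · g⁻¹`, so two facts suffice.

The adjoint representation has no nonzero invariants (`adjoint_invariants_eq_zero`). If `g · m = m ·
g` for all `g`, the span of the `m · h` is stable on the left, and the left action on it inherits
unipotence from the right action. If `m ≠ 0`, a unipotent representation of a nilpotent group on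
this nonzero space fixes a nonzero vector, against the hypothesis.

A finite-dimensional representation of a nilpotent group without nonzero invariants has no
cohomology (`acyclic_of_invariants_eq_zero`). Unless `ρ` is trivial, some `ρ g ≠ 1` commutes with
the whole action. If `ρ g - 1` has a kernel, that kernel and its quotient are smaller
representations, again without invariants, and dimension induction applies. Otherwise `ρ g - 1` is
bijective and `acyclic_of_bijective_sub` applies, by induction along central quotients. With `Z` the
center, the `Z`-equivariant cochains on `G` form a complex of `G ⧸ Z`-representations with no higher
cohomology, whose homology is that of `Z`. On this homology `g` acts as `ρ g` does on values,
because translation by `g⁻¹` is homotopic to the identity. So the hypothesis on `g` passes to the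
homology, which is acyclic over `G ⧸ Z` by induction; dimension shifting makes the complex of
invariants, that is, of `G`-equivariant cochains, exact. This replaces the Hochschild-Serre spectral
sequence. -/

namespace HomogeneousCochain

/-! ### Homogeneous cochains and the prism homotopy -/

section Differential

variable (k : Type*) {X V W : Type*} [CommRing k] [AddCommGroup V] [Module k V]
  [AddCommGroup W] [Module k W]

/-- The alternating sum over the faces, from functions on `Xⁿ` to functions on `Xⁿ⁺¹`. -/
def d (n : ℕ) : ((Fin n → X) → V) →ₗ[k] ((Fin (n + 1) → X) → V) where
  toFun F x := ∑ i : Fin (n + 1), (-1 : k) ^ (i : ℕ) • F (fun j => x (i.succAbove j))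
  map_add' F F' := by
    ext x
    simp [Finset.sum_add_distrib]
  map_smul' r F := by
    ext x
    simp [Finset.smul_sum, smul_comm r]

theorem d_apply (n : ℕ) (F : (Fin n → X) → V) (x : Fin (n + 1) → X) :
    d k n F x = ∑ i : Fin (n + 1), (-1 : k) ^ (i : ℕ) • F (fun j => x (i.succAbove j)) :=
  rfl

/-- The restriction of a function on `Xⁿ⁺¹` to the tuples that start with `a`. -/
def slice {n : ℕ} (F : (Fin (n + 1) → X) → V) (a : X) (x : Fin n → X) : V :=
  F (Fin.cons a x)

omit [AddCommGroup V] in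
theorem eq_of_slice {n : ℕ} {F F' : (Fin (n + 1) → X) → V} (h : ∀ a, slice F a = slice F' a) :
    F = F' := by
  funext x
  have := congrFun (h (x 0)) (Fin.tail x)
  simpa [slice] using this

theorem d_zero_apply (F : (Fin 0 → X) → V) (x : Fin 1 → X) : d k 0 F x = F Fin.elim0 := by
  rw [d_apply]
  simp only [Fin.sum_univ_succ, Fin.sum_univ_zero]
  simp only [Fin.val_zero, pow_zero, one_smul, add_zero]
  exact congrArg F (Subsingleton.elim _ _)

theorem slice_d_zero (F : (Fin 0 → X) → V) (a : X) : slice (d k 0 F) a = F := by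
  funext x
  rw [slice, d_zero_apply]
  exact congrArg F (Subsingleton.elim _ _)

/-- Only the face omitting the first entry forgets `a`. Thus slicing at `a` is a contracting
homotopy of the augmented complex (`G⁰` included), and it drives the inductions below. -/
theorem slice_d_succ (n : ℕ) (F : (Fin (n + 1) → X) → V) (a : X) :
    slice (d k (n + 1) F) a = F - d k n (slice F a) := by
  funext x
  rw [slice, d_apply, Fin.sum_univ_succ, Pi.sub_apply, d_apply, sub_eq_add_neg,
    ← Finset.sum_neg_distrib]
  congr 1
  · simp
  · refine Finset.sum_congr rfl fun i _ => ?_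
    have : (fun j => (Fin.cons a x : Fin (n + 2) → X) (i.succ.succAbove j)) =
        Fin.cons a (fun j => x (i.succAbove j)) := by
      funext j
      refine Fin.cases ?_ (fun j => ?_) j <;> simp
    rw [this, Fin.val_succ, pow_succ, mul_neg_one, neg_smul, slice]

theorem d_d (n : ℕ) (F : (Fin n → X) → V) : d k (n + 1) (d k n F) = 0 := by
  induction n with
  | zero =>
    refine eq_of_slice fun a => ?_
    rw [slice_d_succ, slice_d_zero, sub_self]
    rfl
  | succ n ih =>
    refine eq_of_slice fun a => ?_
    rw [slice_d_succ, slice_d_succ, map_sub, ih, sub_zero, sub_self]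
    rfl

theorem d_comp_linearMap (n : ℕ) (T : V →ₗ[k] W) (F : (Fin n → X) → V) :
    d k n (fun x => T (F x)) = fun x => T (d k n F x) := by
  funext x
  simp [d_apply]

/-- The prism operator: a homotopy between precomposition with `γ : X → X` and the identity. -/
def prism (γ : X → X) : (n : ℕ) → ((Fin (n + 1) → X) → V) → ((Fin n → X) → V)
  | 0, _ => 0
  | n + 1, F => fun x =>
      F (Fin.cons (x 0) (γ ∘ x)) - prism γ n (slice F (x 0)) (Fin.tail x)

theorem slice_prism (γ : X → X) (n : ℕ) (F : (Fin (n + 2) → X) → V) (a : X) :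
    slice (prism γ (n + 1) F) a =
      (fun x => slice (slice F a) (γ a) (γ ∘ x)) - prism γ n (slice F a) := by
  funext x
  simp [slice, prism, Fin.comp_cons]

theorem prism_sub (γ : X → X) (n : ℕ) (F F' : (Fin (n + 1) → X) → V) :
    prism γ n (F - F') = prism γ n F - prism γ n F' := by
  induction n with
  | zero => simp [prism]
  | succ n ih =>
    refine eq_of_slice fun a => ?_
    have h : ∀ {m} (F F' : (Fin (m + 1) → X) → V) a, slice (F - F') a = slice F a - slice F' a :=
      fun _ _ _ => rfl
    rw [h, slice_prism, slice_prism, slice_prism, h, h, ih]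
    funext x
    simp only [Pi.sub_apply]
    abel

/-- Unrolled, `prism γ n F x` is the alternating sum of `F (x₀, …, xᵢ, γ xᵢ, …, γ xₙ₋₁)`. Slicing
off the first entry reduces the homotopy identity to one degree lower. -/
theorem d_prism (γ : X → X) (n : ℕ) (F : (Fin (n + 1) → X) → V) :
    d k n (prism γ n F) + prism γ (n + 1) (d k (n + 1) F) = (fun x => F (γ ∘ x)) - F := by
  have h : ∀ {m} (F F' : (Fin (m + 1) → X) → V) a, slice (F + F') a = slice F a + slice F' a :=
    fun _ _ _ => rfl
  have h' : ∀ {m} (F F' : (Fin (m + 1) → X) → V) a, slice (F - F') a = slice F a - slice F' a :=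
    fun _ _ _ => rfl
  have h'' : ∀ {m} (F : (Fin (m + 1) → X) → V) a,
      slice (fun x => F (γ ∘ x)) a = fun x => slice F (γ a) (γ ∘ x) := by
    intro m F a
    funext x
    simp [slice, Fin.comp_cons]
  induction n with
  | zero =>
    refine eq_of_slice fun a => ?_
    rw [h, slice_prism, slice_d_succ, slice_d_zero, h', h', h'', slice_d_zero]
    funext x
    simp only [prism, Pi.add_apply, Pi.sub_apply, Subsingleton.elim (γ ∘ x) x]
    simp
  | succ n ih =>
    refine eq_of_slice fun a => ?_
    have := ih (slice F a)
    rw [h, slice_prism, slice_d_succ, slice_d_succ, h', h', h'', slice_d_succ, slice_prism,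
      map_sub, prism_sub]
    have e : d k n (fun x => slice (slice F a) (γ a) (γ ∘ x)) =
      fun x => d k n (slice (slice F a) (γ a)) (γ ∘ x) := rfl
    funext x
    have tx := congrFun this x
    simp only [Pi.add_apply, Pi.sub_apply, e] at tx ⊢
    rw [← sub_eq_zero] at tx ⊢
    rw [← tx]
    abel

theorem prism_comm (γ σ : X → X) (hσ : ∀ x, γ (σ x) = σ (γ x)) (T : V →ₗ[k] W) (n : ℕ)
    (F : (Fin (n + 1) → X) → V) (F' : (Fin (n + 1) → X) → W)
    (hF : ∀ x, F' (σ ∘ x) = T (F x)) (x : Fin n → X) :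
    prism γ n F' (σ ∘ x) = T (prism γ n F x) := by
  induction n with
  | zero => simp [prism]
  | succ n ih =>
    simp only [prism, map_sub]
    congr 1
    · rw [← hF, Fin.comp_cons]
      congr 2
      funext i
      exact hσ (x i)
    · refine ih (slice F (x 0)) (slice F' (σ (x 0))) (fun y => ?_) (Fin.tail x)
      rw [slice, slice, ← hF, Fin.comp_cons]

end Differential

end HomogeneousCochain

/-! ### Equivariant cochains and pieces of the long exact sequence -/

namespace HomogeneousCochain

section Equivariant

variable {k G V W U : Type*} [CommRing k] [Group G] [AddCommGroup V] [Module k V]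
  [AddCommGroup W] [Module k W] [AddCommGroup U] [Module k U]

/-- Functions on `Gⁿ` with values in a representation that commute with the diagonal action. -/
def IsEquivariant (ρ : Representation k G V) {n : ℕ} (F : (Fin n → G) → V) : Prop :=
  ∀ h x, F (h • x) = ρ h (F x)

/-- The cohomology of `G` in degree `p > 0` with coefficients in `ρ` vanishes; in degree `p = 0`
this is no condition, see `vanishes_zero`. -/
def Vanishes (ρ : Representation k G V) (p : ℕ) : Prop :=
  ∀ F : (Fin (p + 1) → G) → V, IsEquivariant ρ F → d k (p + 1) F = 0 →
    ∃ E : (Fin p → G) → V, IsEquivariant ρ E ∧ d k p E = F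

/-- The cohomology of `G` with coefficients in `ρ` vanishes in all degrees. -/
def Acyclic (ρ : Representation k G V) : Prop :=
  (∀ v, (∀ g, ρ g v = v) → v = 0) ∧ ∀ p, Vanishes ρ p

theorem IsEquivariant.d {ρ : Representation k G V} {n : ℕ} {F : (Fin n → G) → V}
    (hF : IsEquivariant ρ F) : IsEquivariant ρ (d k n F) := by
  intro h x
  rw [d_apply, d_apply, map_sum]
  refine Finset.sum_congr rfl fun i _ => ?_
  rw [map_smul, ← hF]
  rfl

theorem IsEquivariant.sub {ρ : Representation k G V} {n : ℕ} {F F' : (Fin n → G) → V}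
    (hF : IsEquivariant ρ F) (hF' : IsEquivariant ρ F') : IsEquivariant ρ (F - F') :=
  fun h x => by rw [Pi.sub_apply, Pi.sub_apply, map_sub, hF, hF']

theorem IsEquivariant.add {ρ : Representation k G V} {n : ℕ} {F F' : (Fin n → G) → V}
    (hF : IsEquivariant ρ F) (hF' : IsEquivariant ρ F') : IsEquivariant ρ (F + F') :=
  fun h x => by rw [Pi.add_apply, Pi.add_apply, map_add, hF, hF']

theorem IsEquivariant.comp {ρ : Representation k G V} {σ : Representation k G W} {n : ℕ}
    {F : (Fin n → G) → V} (hF : IsEquivariant ρ F) (f : V →ₗ[k] W)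
    (hf : ∀ g v, f (ρ g v) = σ g (f v)) : IsEquivariant σ (fun x => f (F x)) :=
  fun h x => by simp only [hF h x, hf]

/-- A cocycle in homogeneous degree one is constant, with an invariant value. -/
theorem vanishes_zero (ρ : Representation k G V) : Vanishes ρ 0 := by
  intro F hF hd
  have hc : ∀ x y : Fin 1 → G, F x = F y := by
    intro x y
    have := congrFun (slice_d_succ k 0 F (y 0)) x
    rw [hd, Pi.sub_apply, d_zero_apply] at this
    rw [sub_eq_zero.1 this.symm, slice]
    congr 1
    funext i
    fin_cases i
    rfl
  refine ⟨fun _ => F 1, fun h _ => ?_, ?_⟩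
  · rw [← hF]
    exact hc _ _
  · funext x
    rw [d_zero_apply]
    exact hc _ _

theorem Acyclic.eq_zero {ρ : Representation k G V} (hρ : Acyclic ρ) {F : (Fin 1 → G) → V}
    (hF : IsEquivariant ρ F) (hd : d k 1 F = 0) : F = 0 := by
  obtain ⟨E, hE, rfl⟩ := hρ.2 0 F hF hd
  funext x
  rw [d_zero_apply]
  refine hρ.1 _ fun g => ?_
  rw [← hE]
  exact congrArg E (Subsingleton.elim _ _)

theorem Vanishes.of_equiv {ρ : Representation k G V} {σ : Representation k G W} {p : ℕ}
    (e : V ≃ₗ[k] W) (he : ∀ g v, e (ρ g v) = σ g (e v)) (h : Vanishes ρ p) : Vanishes σ p := by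
  intro F hF hd
  have he' : ∀ g w, e.symm (σ g w) = ρ g (e.symm w) := fun g w => by
    rw [e.symm_apply_eq, he, e.apply_symm_apply]
  obtain ⟨E, hE, hEF⟩ := h _ (hF.comp e.symm.toLinearMap he') (by
    rw [d_comp_linearMap, hd]
    funext x
    simp)
  refine ⟨_, hE.comp e.toLinearMap he, ?_⟩
  rw [d_comp_linearMap, hEF]
  funext x
  simp

variable {ρ : Representation k G V} {σ : Representation k G W} {τ : Representation k G U}

/-- `G` acts freely on nonempty tuples: lift arbitrarily where the first entry is `1`, then
translate. Hence the `n + 1`. -/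
theorem IsEquivariant.exists_lift {f : V →ₗ[k] W} (hf : ∀ g v, f (ρ g v) = σ g (f v)) {n : ℕ}
    {F : (Fin (n + 1) → G) → W} (hF : IsEquivariant σ F) (hr : ∀ x, F x ∈ LinearMap.range f) :
    ∃ F' : (Fin (n + 1) → G) → V, IsEquivariant ρ F' ∧ ∀ x, f (F' x) = F x := by
  choose s hs using hr
  refine ⟨fun x => ρ (x 0) (s ((x 0)⁻¹ • x)), fun h x => ?_, fun x => ?_⟩
  · have : ((h • x) 0)⁻¹ • h • x = (x 0)⁻¹ • x := by
      funext i
      simp [mul_assoc]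
    simp only [this]
    simp
  · simp only [hf, hs]
    rw [← hF, smul_inv_smul]

/-- An equivariant function into the range of an injective equivariant map factors through it. -/
theorem IsEquivariant.exists_restrict {f : V →ₗ[k] W} (hf : ∀ g v, f (ρ g v) = σ g (f v))
    (hi : Function.Injective f) {n : ℕ} {F : (Fin n → G) → W} (hF : IsEquivariant σ F)
    (hr : ∀ x, F x ∈ LinearMap.range f) :
    ∃ F' : (Fin n → G) → V, IsEquivariant ρ F' ∧ ∀ x, f (F' x) = F x := by
  choose s hs using hr
  refine ⟨s, fun h x => hi ?_, hs⟩
  rw [hs, hf, hs, hF]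

variable {i : V →ₗ[k] W} {f : W →ₗ[k] U}

omit [Group G] in
theorem eq_zero_of_injective {n : ℕ} (hi : Function.Injective i) {F : (Fin n → G) → V}
    (h : (fun x => i (F x)) = 0) : F = 0 := by
  funext x
  exact hi (by simpa using congrFun h x)

/-- From `0 → V → W → U → 0`: vanishing for the middle term and, one degree up, for the
subobject gives vanishing for the quotient. -/
theorem Vanishes.quotient (hiρ : ∀ g v, i (ρ g v) = σ g (i v))
    (hfσ : ∀ g w, f (σ g w) = τ g (f w)) (hi : Function.Injective i)
    (hf : Function.Surjective f) (hif : LinearMap.range i = LinearMap.ker f) {p : ℕ}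
    (hV : Vanishes ρ (p + 1)) (hW : Vanishes σ p) : Vanishes τ p := by
  intro F hF hd
  -- The connecting homomorphism: the coboundary of a lift is a cocycle in `V`, and its primitive
  -- there corrects the lift to a cocycle.
  obtain ⟨F', hF', hFF'⟩ := hF.exists_lift hfσ fun x => hf (F x)
  obtain ⟨A, hA, hAF⟩ := hF'.d.exists_restrict hiρ hi fun x => by
    rw [hif, LinearMap.mem_ker]
    have := congrFun (d_comp_linearMap k _ f F') x
    rw [← this, show (fun x => f (F' x)) = F from funext hFF', hd]
    rfl
  obtain ⟨E, hE, rfl⟩ := hV A hA (eq_zero_of_injective hi (by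
    rw [← d_comp_linearMap, show (fun x => i (A x)) = _ from funext hAF, d_d]))
  obtain ⟨E', hE', hEF'⟩ := hW (F' - fun x => i (E x)) (hF'.sub (hE.comp i hiρ)) (by
    rw [map_sub, d_comp_linearMap, show (fun x => i _) = _ from funext hAF, sub_self])
  refine ⟨_, hE'.comp f hfσ, ?_⟩
  rw [d_comp_linearMap, hEF']
  funext x
  have : i (E x) ∈ LinearMap.ker f := hif ▸ ⟨_, rfl⟩
  simp [hFF', LinearMap.mem_ker.1 this]

/-- If the first cohomology of the subobject vanishes, invariants of the quotient lift. -/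
theorem Vanishes.exists_invariant_lift (hiρ : ∀ g v, i (ρ g v) = σ g (i v))
    (hfσ : ∀ g w, f (σ g w) = τ g (f w)) (hi : Function.Injective i)
    (hf : Function.Surjective f) (hif : LinearMap.range i = LinearMap.ker f)
    (hV : Vanishes ρ 1) {u : U} (hu : ∀ g, τ g u = u) :
    ∃ w, (∀ g, σ g w = w) ∧ f w = u := by
  obtain ⟨w₀, rfl⟩ := hf u
  -- The orbit map of an arbitrary lift `w₀` is an equivariant cochain in degree `0`. Its coboundary
  -- has values in `V`; after correction it is a cocycle, hence constant with invariant value.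
  obtain ⟨A, hA, hAF⟩ : ∃ A : (Fin 2 → G) → V, IsEquivariant ρ A ∧
      ∀ x, i (A x) = d k 1 (fun y => σ (y 0) w₀) x := by
    refine IsEquivariant.exists_restrict hiρ hi
      (IsEquivariant.d (F := fun y : Fin 1 → G => σ (y 0) w₀) fun h x => by simp) fun x => ?_
    rw [hif, LinearMap.mem_ker, ← congrFun (d_comp_linearMap k _ f _) x]
    simp [hfσ, hu, d_apply, Fin.sum_univ_two]
  obtain ⟨E, hE, rfl⟩ := hV A hA (eq_zero_of_injective hi (by
    rw [← d_comp_linearMap, show (fun x => i (A x)) = _ from funext hAF, d_d]))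
  obtain ⟨w, hw, hwE⟩ := vanishes_zero σ ((fun y => σ (y 0) w₀) - fun x => i (E x))
    (IsEquivariant.sub (fun h x => by simp) (hE.comp i hiρ)) (by
      rw [map_sub, d_comp_linearMap, show (fun x => i _) = _ from funext hAF, sub_self])
  refine ⟨w Fin.elim0, fun g => ?_, ?_⟩
  · rw [← hw]
    exact congrArg w (Subsingleton.elim _ _)
  · have := congrFun hwE 1
    rw [d_zero_apply] at this
    have h0 : i (E 1) ∈ LinearMap.ker f := hif ▸ ⟨_, rfl⟩
    simp [this, LinearMap.mem_ker.1 h0]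

/-- From `0 → V → W → U → 0`: vanishing for the two outer terms gives it for the middle term. -/
theorem Vanishes.extension (hiρ : ∀ g v, i (ρ g v) = σ g (i v))
    (hfσ : ∀ g w, f (σ g w) = τ g (f w)) (hi : Function.Injective i)
    (hf : Function.Surjective f) (hif : LinearMap.range i = LinearMap.ker f) {p : ℕ}
    (hV : Vanishes ρ p) (hU : Vanishes τ p) : Vanishes σ p := by
  cases p with
  | zero => exact vanishes_zero σ
  | succ p =>
    intro F hF hd
    obtain ⟨E, hE, hEF⟩ := hU _ (hF.comp f hfσ) (by
      rw [d_comp_linearMap, hd]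
      funext x
      simp)
    obtain ⟨E', hE', hEE'⟩ := hE.exists_lift hfσ fun x => hf (E x)
    obtain ⟨A, hA, hAF⟩ := (hF.sub hE'.d).exists_restrict hiρ hi fun x => by
      rw [hif, LinearMap.mem_ker, Pi.sub_apply, map_sub, ← congrFun (d_comp_linearMap k _ f E') x,
        show (fun x => f (E' x)) = E from funext hEE', hEF, sub_self]
    obtain ⟨D, hD, rfl⟩ := hV A hA (eq_zero_of_injective hi (by
      rw [← d_comp_linearMap, show (fun x => i (A x)) = _ from funext hAF, map_sub, hd, d_d,
        sub_zero]))
    refine ⟨E' + fun x => i (D x), hE'.add (hD.comp i hiρ), ?_⟩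
    rw [map_add, d_comp_linearMap, show (fun x => i _) = _ from funext hAF, add_sub_cancel]

end Equivariant

end HomogeneousCochain

/-! ### Dimension shifting along a complex of representations -/

namespace HomogeneousCochain

section Complex

variable {k Q : Type*} [CommRing k] [Group Q]

section Maps

variable {V W U : Type*} [AddCommGroup V] [Module k V] [AddCommGroup W] [Module k W]
  [AddCommGroup U] [Module k U]
  {ρ : Representation k Q V} {σ : Representation k Q W} {τ : Representation k Q U}

/-- The kernel of an equivariant map, as a representation. -/
def kerRep {f : V →ₗ[k] W} (hf : ∀ g v, f (ρ g v) = σ g (f v)) :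
    Representation k Q (LinearMap.ker f) :=
  ρ.subrepresentation (LinearMap.ker f) fun g v hv => by
    rw [Submodule.mem_comap, LinearMap.mem_ker, hf, LinearMap.mem_ker.1 hv, map_zero]

/-- The range of an equivariant map, as a representation. -/
def rangeRep {f : V →ₗ[k] W} (hf : ∀ g v, f (ρ g v) = σ g (f v)) :
    Representation k Q (LinearMap.range f) :=
  σ.subrepresentation (LinearMap.range f) fun g => by
    rintro _ ⟨v, rfl⟩
    exact ⟨ρ g v, hf g v⟩

/-- The homology of two composable equivariant maps, as a representation. -/
def homologyRep {i : V →ₗ[k] W} {f : W →ₗ[k] U} (hi : ∀ g v, i (ρ g v) = σ g (i v))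
    (hf : ∀ g w, f (σ g w) = τ g (f w)) :
    Representation k Q (LinearMap.ker f ⧸ (LinearMap.range i).comap (LinearMap.ker f).subtype) :=
  (kerRep hf).quotient _ fun g => by
    rintro ⟨_, hw⟩ ⟨v, rfl⟩
    exact ⟨ρ g v, hi g v⟩

end Maps

variable {K : ℕ → Type*} [∀ n, AddCommGroup (K n)] [∀ n, Module k (K n)]
  {κ : ∀ n, Representation k Q (K n)} {δ : ∀ n, K n →ₗ[k] K (n + 1)}

/-- Uses the sequence cycles → cochains → boundaries. -/
theorem vanishes_range (hδ : ∀ n g v, δ n (κ n g v) = κ (n + 1) g (δ n v))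
    (hκ : ∀ n p, Vanishes (κ n) p) (n : ℕ) (h : ∀ p, Vanishes (kerRep (hδ n)) p) (p : ℕ) :
    Vanishes (rangeRep (hδ n)) p :=
  Vanishes.quotient (i := (LinearMap.ker (δ n)).subtype) (f := (δ n).rangeRestrict)
    (ρ := kerRep (hδ n)) (σ := κ n) (τ := rangeRep (hδ n)) (fun _ _ => rfl) (fun g v => Subtype.ext (hδ n g v))
    (Submodule.subtype_injective _) (δ n).surjective_rangeRestrict
    (by rw [Submodule.range_subtype, LinearMap.ker_rangeRestrict]) (h (p + 1)) (hκ n p)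

/-- The inclusion of the boundaries into the cycles. -/
def rangeToKer (hδδ : ∀ n v, δ (n + 1) (δ n v) = 0) (n : ℕ) :
    LinearMap.range (δ n) →ₗ[k] LinearMap.ker (δ (n + 1)) :=
  Submodule.inclusion (by rintro _ ⟨v, rfl⟩; exact hδδ n v)

/-- Induction on `n` along boundaries → cycles → homology, alternating with `vanishes_range`. -/
theorem vanishes_ker (hδ : ∀ n g v, δ n (κ n g v) = κ (n + 1) g (δ n v))
    (hδδ : ∀ n v, δ (n + 1) (δ n v) = 0) (hκ : ∀ n p, Vanishes (κ n) p)
    (h0 : Acyclic (kerRep (hδ 0))) (hH : ∀ n, Acyclic (homologyRep (hδ n) (hδ (n + 1)))) (n : ℕ) :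
    ∀ p, Vanishes (kerRep (hδ n)) p := by
  induction n with
  | zero => exact h0.2
  | succ n ih =>
    intro p
    refine Vanishes.extension (i := rangeToKer hδδ n) (f := Submodule.mkQ _)
      (ρ := rangeRep (hδ n)) (τ := homologyRep (hδ n) (hδ (n + 1)))
      (fun _ _ => rfl) (fun _ _ => rfl) (Submodule.inclusion_injective _)
      (Submodule.mkQ_surjective _) ?_ (vanishes_range hδ hκ n ih p) ((hH n).2 p)
    rw [Submodule.ker_mkQ, rangeToKer, Submodule.range_inclusion]

/-- If the terms of a complex of representations have no higher cohomology and its homology has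
no cohomology at all, then the complex of invariants is exact. -/
theorem exists_invariant_preimage (hδ : ∀ n g v, δ n (κ n g v) = κ (n + 1) g (δ n v))
    (hδδ : ∀ n v, δ (n + 1) (δ n v) = 0) (hκ : ∀ n p, Vanishes (κ n) p)
    (h0 : Acyclic (kerRep (hδ 0))) (hH : ∀ n, Acyclic (homologyRep (hδ n) (hδ (n + 1)))) (n : ℕ)
    {v : K (n + 1)} (hv : ∀ g, κ (n + 1) g v = v) (hd : δ (n + 1) v = 0) :
    ∃ w, (∀ g, κ n g w = w) ∧ δ n w = v := by
  -- The homology class of `v` is invariant, hence zero.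
  have hr : v ∈ LinearMap.range (δ n) := by
    have := (hH n).1 (Submodule.Quotient.mk ⟨v, hd⟩) fun g =>
      congrArg Submodule.Quotient.mk (Subtype.ext (hv g))
    rw [Submodule.Quotient.mk_eq_zero] at this
    exact this
  obtain ⟨w, hw, hwv⟩ := Vanishes.exists_invariant_lift (ρ := kerRep (hδ n)) (σ := κ n)
    (τ := rangeRep (hδ n)) (i := (LinearMap.ker (δ n)).subtype)
    (f := (δ n).rangeRestrict) (fun _ _ => rfl) (fun g v => Subtype.ext (hδ n g v))
    (Submodule.subtype_injective _) (δ n).surjective_rangeRestrict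
    (by rw [Submodule.range_subtype, LinearMap.ker_rangeRestrict])
    (vanishes_ker hδ hδδ hκ h0 hH n 1) (u := ⟨v, hr⟩) (fun g => Subtype.ext (hv g))
  exact ⟨w, hw, congrArg Subtype.val hwv⟩

end Complex

end HomogeneousCochain

/-! ### Cochains equivariant under the center -/

namespace HomogeneousCochain

section Relative

variable {k G V : Type*} [CommRing k] [Group G] [AddCommGroup V] [Module k V]

/-- The action of `G` on functions `Gⁿ → V` whose fixed points are the equivariant functions. -/
def funRep (ρ : Representation k G V) (n : ℕ) : Representation k G ((Fin n → G) → V) where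
  toFun g :=
    { toFun := fun F x => ρ g (F (g⁻¹ • x))
      map_add' := fun F F' => by
        funext x
        simp
      map_smul' := fun r F => by
        funext x
        simp }
  map_one' := by
    ext F x
    simp
  map_mul' g h := by
    ext F x
    simp [mul_smul]

theorem funRep_apply (ρ : Representation k G V) (n : ℕ) (g : G) (F : (Fin n → G) → V)
    (x : Fin n → G) : funRep ρ n g F x = ρ g (F (g⁻¹ • x)) :=
  rfl

theorem isEquivariant_iff {ρ : Representation k G V} {n : ℕ} {F : (Fin n → G) → V} :
    IsEquivariant ρ F ↔ ∀ g, funRep ρ n g F = F := by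
  refine ⟨fun h g => funext fun x => ?_, fun h g x => ?_⟩
  · rw [funRep_apply, ← h, smul_inv_smul]
  · conv_lhs => rw [← h g]
    rw [funRep_apply, inv_smul_smul]

theorem d_funRep (ρ : Representation k G V) (n : ℕ) (g : G) (F : (Fin n → G) → V) :
    d k n (funRep ρ n g F) = funRep ρ (n + 1) g (d k n F) := by
  funext x
  rw [funRep_apply, d_apply, d_apply, map_sum]
  refine Finset.sum_congr rfl fun i _ => ?_
  rw [map_smul]
  rfl

/-- Functions on `Gⁿ` that are equivariant under the center. -/
noncomputable abbrev CentralCochain (ρ : Representation k G V) (n : ℕ) : Submodule k ((Fin n → G) → V) :=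
  Representation.invariants ((funRep ρ n).comp (Subgroup.center G).subtype)

/-- The action of the central quotient on functions that are equivariant under the center. -/
noncomputable abbrev centralRep (ρ : Representation k G V) (n : ℕ) :
    Representation k (G ⧸ Subgroup.center G) (CentralCochain ρ n) :=
  (funRep ρ n).quotientToInvariants (Subgroup.center G)

theorem mem_centralCochain {ρ : Representation k G V} {n : ℕ} {F : (Fin n → G) → V} :
    F ∈ CentralCochain ρ n ↔ ∀ z ∈ Subgroup.center G, ∀ x, F (z • x) = ρ z (F x) := by
  refine ⟨fun h z hz x => ?_, fun h z => funext fun x => ?_⟩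
  · have := congrFun (h ⟨z, hz⟩) (z • x)
    rw [← this]
    exact congrArg (fun y => ρ z (F y)) (inv_smul_smul z x)
  · have := h z z.2 ((z : G)⁻¹ • x)
    rw [smul_inv_smul] at this
    exact this.symm

/-- The differential on functions that are equivariant under the center. -/
noncomputable def centralD (ρ : Representation k G V) (n : ℕ) :
    CentralCochain ρ n →ₗ[k] CentralCochain ρ (n + 1) :=
  (d k n).restrict fun F hF z => by
    have := d_funRep ρ n z F
    rw [show funRep ρ n z F = F from hF z] at this
    exact this.symm

theorem centralD_centralRep (ρ : Representation k G V) (n : ℕ) (q : G ⧸ Subgroup.center G)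
    (F : CentralCochain ρ n) :
    centralD ρ n (centralRep ρ n q F) = centralRep ρ (n + 1) q (centralD ρ n F) := by
  induction q using QuotientGroup.induction_on with
  | H g => exact Subtype.ext (d_funRep ρ n g F)

theorem centralD_centralD (ρ : Representation k G V) (n : ℕ) (F : CentralCochain ρ n) :
    centralD ρ (n + 1) (centralD ρ n F) = 0 :=
  Subtype.ext (d_d k n F.1)

/-- These cochains behave like a coinduced module: inserting the class of `x 0` as an extra first
argument of `φ` is an equivariant contracting homotopy. It needs an entry `x 0`, so functions on
`G⁰` are excluded. -/
theorem vanishes_centralRep (ρ : Representation k G V) (n p : ℕ) :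
    Vanishes (centralRep ρ (n + 1)) p := by
  intro φ hφ hd
  let π : G → G ⧸ Subgroup.center G := QuotientGroup.mk
  have hπ : ∀ z ∈ Subgroup.center G, ∀ a, π (z * a) = π a := fun z hz a =>
    QuotientGroup.eq.2 (by
      rw [← (Subgroup.mem_center_iff.1 hz a)]
      simpa [mul_assoc] using inv_mem hz)
  refine ⟨fun q => ⟨fun x => (φ (Fin.cons (π (x 0)) q)).1 x, ?_⟩, ?_, ?_⟩
  · refine mem_centralCochain.2 fun z hz x => ?_
    rw [← mem_centralCochain.1 (φ _).2 z hz, Pi.smul_apply, smul_eq_mul, hπ z hz]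
  · intro q y
    induction q using QuotientGroup.induction_on with
    | H g =>
      refine Subtype.ext (funext fun x => ?_)
      have := hφ g (Fin.cons (π (g⁻¹ * x 0)) y)
      have hc : (g : G ⧸ Subgroup.center G) •
          (Fin.cons (π (g⁻¹ * x 0)) y : Fin (p + 1) → G ⧸ Subgroup.center G) =
          Fin.cons (π (x 0)) ((g : G ⧸ Subgroup.center G) • y) := by
        funext i
        refine Fin.cases ?_ (fun i => ?_) i
        · change π (g * (g⁻¹ * x 0)) = π (x 0)
          rw [mul_inv_cancel_left]
        · rfl
      rw [hc] at this
      exact congrFun (congrArg Subtype.val this) x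
  · funext q
    refine Subtype.ext (funext fun x => ?_)
    have := congrFun (slice_d_succ k p φ (π (x 0))) q
    rw [hd, Pi.sub_apply] at this
    have hx := congrFun (congrArg Subtype.val (sub_eq_zero.1 this.symm)) x
    rw [hx, d_apply, d_apply, AddSubmonoidClass.coe_finsetSum, AddSubmonoidClass.coe_finsetSum,
      Finset.sum_apply, Finset.sum_apply]
    rfl

/-- Postcomposition with an endomorphism of the representation. -/
noncomputable def centralMap {ρ : Representation k G V} {S : V →ₗ[k] V} (hS : ∀ g v, S (ρ g v) = ρ g (S v))
    (n : ℕ) : CentralCochain ρ n →ₗ[k] CentralCochain ρ n :=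
  (S.compLeft (Fin n → G)).restrict fun F hF => mem_centralCochain.2 fun z hz x => by
    simp [mem_centralCochain.1 hF z hz, hS]

theorem centralD_centralMap {ρ : Representation k G V} {S : V →ₗ[k] V}
    (hS : ∀ g v, S (ρ g v) = ρ g (S v)) (n : ℕ) (F : CentralCochain ρ n) :
    centralD ρ n (centralMap hS n F) = centralMap hS (n + 1) (centralD ρ n F) :=
  Subtype.ext (d_comp_linearMap k n S F.1)

theorem centralRep_centralMap {ρ : Representation k G V} {S : V →ₗ[k] V}
    (hS : ∀ g v, S (ρ g v) = ρ g (S v)) (n : ℕ) (q : G ⧸ Subgroup.center G)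
    (F : CentralCochain ρ n) :
    centralRep ρ n q (centralMap hS n F) = centralMap hS n (centralRep ρ n q F) := by
  induction q using QuotientGroup.induction_on with
  | H g => exact Subtype.ext (funext fun x => (hS g _).symm)

/-- The prism operator for left translation, on functions that are equivariant under the
center. -/
noncomputable def centralPrism {ρ : Representation k G V} (g : G) (n : ℕ) (F : CentralCochain ρ (n + 1)) :
    CentralCochain ρ n :=
  ⟨prism (g⁻¹ * ·) n F.1, mem_centralCochain.2 fun z hz x =>
    prism_comm (k := k) (g⁻¹ * ·) (z * ·) (fun y => by
      rw [← mul_assoc, Subgroup.mem_center_iff.1 hz, mul_assoc]) (ρ z) n F.1 F.1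
      (mem_centralCochain.1 F.2 z hz) x⟩

/-- The action of `g` is left translation by `g⁻¹` followed by `ρ g`, and the prism removes the
translation up to a coboundary. The prism preserves central equivariance because translation by
`g⁻¹` commutes with the center. -/
theorem centralRep_sub_centralMap {ρ : Representation k G V} {g : G}
    (hg : ∀ h v, ρ g (ρ h v) = ρ h (ρ g v)) (n : ℕ) (F : CentralCochain ρ (n + 1))
    (hF : centralD ρ (n + 1) F = 0) :
    centralRep ρ (n + 1) g F - centralMap hg (n + 1) F =
      centralD ρ n (centralMap hg n (centralPrism g n F)) := by
  rw [centralD_centralMap]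
  refine Subtype.ext (funext fun x => ?_)
  have h := d_prism k (g⁻¹ * ·) n F.1
  rw [show d k (n + 1) F.1 = 0 from congrArg Subtype.val hF] at h
  have hz : prism (g⁻¹ * ·) (n + 1) (0 : (Fin (n + 2) → G) → V) = 0 := by
    simpa using prism_sub (g⁻¹ * ·) (n + 1) (0 : (Fin (n + 2) → G) → V) 0
  rw [hz, add_zero] at h
  have hx := congrArg (ρ g) (congrFun h x)
  rw [Pi.sub_apply, map_sub] at hx
  exact hx.symm

end Relative

/-! ### Transfer of the commuting, invertible action to homology -/

section Homology

variable {k Q V W U : Type*} [CommRing k] [Group Q] [AddCommGroup V] [Module k V]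
  [AddCommGroup W] [Module k W] [AddCommGroup U] [Module k U]
  {ρ : Representation k Q V} {σ : Representation k Q W} {τ : Representation k Q U}
  {i : V →ₗ[k] W} {f : W →ₗ[k] U} {q : Q} {T S : W →ₗ[k] W}

theorem kerRep_commute (hf : ∀ g w, f (σ g w) = τ g (f w))
    (hT : ∀ h w, T (σ h w) = σ h (T w)) (hq : ∀ w, f w = 0 → σ q w = T w) (h : Q)
    (y : LinearMap.ker f) :
    kerRep hf q (kerRep hf h y) = kerRep hf h (kerRep hf q y) := by
  refine Subtype.ext ?_
  change σ q (σ h y) = σ h (σ q y)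
  rw [hq y y.2, hq _ (by rw [hf, LinearMap.mem_ker.1 y.2, map_zero]), hT]

theorem kerRep_bijective (hf : ∀ g w, f (σ g w) = τ g (f w))
    (hST : ∀ w, S (T w - w) = w) (hTS : ∀ w, T (S w) - S w = w)
    (hS : ∀ w, f w = 0 → f (S w) = 0) (hq : ∀ w, f w = 0 → σ q w = T w) :
    Function.Bijective fun y => kerRep hf q y - y := by
  constructor
  · intro y y' h
    have h : σ q y - y = σ q y' - y' := congrArg Subtype.val h
    rw [hq y y.2, hq y' y'.2] at h
    exact Subtype.ext (by rw [← hST y, h, hST])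
  · intro y
    refine ⟨⟨S y, hS y y.2⟩, Subtype.ext ?_⟩
    change σ q (S y) - S y = y
    rw [hq _ (hS y y.2), hTS]

theorem homologyRep_commute (hi : ∀ g v, i (ρ g v) = σ g (i v))
    (hf : ∀ g w, f (σ g w) = τ g (f w)) (hT : ∀ h w, T (σ h w) = σ h (T w))
    (hq : ∀ w, f w = 0 → σ q w - T w ∈ LinearMap.range i) (h : Q)
    (y : LinearMap.ker f ⧸ (LinearMap.range i).comap (LinearMap.ker f).subtype) :
    homologyRep hi hf q (homologyRep hi hf h y) = homologyRep hi hf h (homologyRep hi hf q y) := by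
  obtain ⟨⟨w, hw⟩, rfl⟩ := Submodule.Quotient.mk_surjective _ y
  refine (Submodule.Quotient.eq _).2 ?_
  change σ q (σ h w) - σ h (σ q w) ∈ LinearMap.range i
  have h1 := hq (σ h w) (by rw [hf, LinearMap.mem_ker.1 hw, map_zero])
  obtain ⟨v, hv⟩ := hq w hw
  have h2 : σ h (σ q w - T w) ∈ LinearMap.range i := ⟨ρ h v, by rw [hi, hv]⟩
  have := sub_mem h1 h2
  rwa [map_sub, hT, sub_sub_sub_cancel_right] at this

/-- `S` inverts `T - 1` and preserves cycles and boundaries, while `q` acts as `T` modulo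
boundaries; so `S` induces the inverse. -/
theorem homologyRep_bijective (hi : ∀ g v, i (ρ g v) = σ g (i v))
    (hf : ∀ g w, f (σ g w) = τ g (f w)) (hST : ∀ w, S (T w - w) = w)
    (hTS : ∀ w, T (S w) - S w = w) (hS : ∀ w, f w = 0 → f (S w) = 0)
    (hSi : ∀ v, S (i v) ∈ LinearMap.range i)
    (hq : ∀ w, f w = 0 → σ q w - T w ∈ LinearMap.range i) :
    Function.Bijective fun y => homologyRep hi hf q y - y := by
  constructor
  · intro y y' h
    obtain ⟨⟨w, hw⟩, rfl⟩ := Submodule.Quotient.mk_surjective _ y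
    obtain ⟨⟨w', hw'⟩, rfl⟩ := Submodule.Quotient.mk_surjective _ y'
    have hmk : ∀ y : LinearMap.ker f, homologyRep hi hf q (Submodule.Quotient.mk y) -
        Submodule.Quotient.mk y = Submodule.Quotient.mk (kerRep hf q y - y) := fun _ => rfl
    have h := (Submodule.Quotient.eq _).1
      ((hmk ⟨w, hw⟩).symm.trans (h.trans (hmk ⟨w', hw'⟩)))
    change σ q w - w - (σ q w' - w') ∈ LinearMap.range i at h
    refine (Submodule.Quotient.eq _).2 ?_
    change w - w' ∈ LinearMap.range i
    have h1 := hq (w - w') (by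
      rw [map_sub, LinearMap.mem_ker.1 hw, LinearMap.mem_ker.1 hw', sub_zero])
    obtain ⟨v, hv⟩ := sub_mem h h1
    rw [← hST (w - w'), show T (w - w') - (w - w') = i v by
      rw [hv, map_sub (σ q)]
      abel]
    exact hSi v
  · intro y
    obtain ⟨⟨w, hw⟩, rfl⟩ := Submodule.Quotient.mk_surjective _ y
    refine ⟨Submodule.Quotient.mk ⟨S w, hS w hw⟩, (Submodule.Quotient.eq _).2 ?_⟩
    change σ q (S w) - S w - w ∈ LinearMap.range i
    have := hq _ (hS w hw)
    nth_rewrite 3 [← hTS w]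
    rwa [sub_sub_sub_cancel_right]

end Homology

/-! ### Induction along central quotients -/

section Nilpotent

universe u v w

theorem acyclic_of_quotient_center {k : Type u} {G : Type v} {V : Type w} [CommRing k] [Group G]
    [AddCommGroup V] [Module k V] {ρ : Representation k G V} {g : G}
    (IH : ∀ {H : Type (max v w)} [AddCommGroup H] [Module k H]
      (σ : Representation k (G ⧸ Subgroup.center G) H),
      (∀ q v, σ g (σ q v) = σ q (σ g v)) → (Function.Bijective fun v => σ g v - v) → Acyclic σ)
    (hg : ∀ h v, ρ g (ρ h v) = ρ h (ρ g v)) (hu : Function.Bijective fun v => ρ g v - v) :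
    Acyclic ρ := by
  obtain ⟨S, hS₁, hS₂⟩ : ∃ S : V →ₗ[k] V, (∀ v, S (ρ g v - v) = v) ∧ ∀ v, ρ g (S v) - S v = v :=
    let e := LinearEquiv.ofBijective (ρ g - LinearMap.id) hu
    ⟨e.symm.toLinearMap, fun v => by change e.symm (e v) = v; exact e.symm_apply_apply v,
      fun v => by change e (e.symm v) = v; exact e.apply_symm_apply v⟩
  have hS : ∀ h v, S (ρ h v) = ρ h (S v) := fun h v => hu.1 (by
    simp only [hS₂, hg, ← map_sub])
  refine ⟨fun v hv => hu.1 (by simp [hv g]), fun p => ?_⟩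
  cases p with
  | zero => exact vanishes_zero ρ
  | succ p =>
    have hT := fun n (F : CentralCochain ρ (n + 1)) => centralRep_sub_centralMap hg n F
    have hST : ∀ n (F : CentralCochain ρ n), centralMap hS n (centralMap hg n F - F) = F :=
      fun n F => Subtype.ext (funext fun x => hS₁ _)
    have hTS : ∀ n (F : CentralCochain ρ n),
        centralMap hg n (centralMap hS n F) - centralMap hS n F = F :=
      fun n F => Subtype.ext (funext fun x => hS₂ _)
    have hSd : ∀ n (F : CentralCochain ρ n), centralD ρ n F = 0 →
        centralD ρ n (centralMap hS n F) = 0 := fun n F hF => by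
      rw [centralD_centralMap, hF, map_zero]
    -- The lowest homology is the kernel itself, not a quotient by functions on `G⁰`. Equality is
    -- exact there because the lowest prism is zero.
    have h1 : ∀ F : CentralCochain ρ 1, centralD ρ 1 F = 0 →
        centralRep ρ 1 g F = centralMap hg 1 F := fun F hF => by
      rw [← sub_eq_zero, hT 0 F hF, centralD_centralMap]
      have : centralPrism g 0 F = 0 := Subtype.ext rfl
      rw [this, map_zero, map_zero]
    have h0 : Acyclic (kerRep (centralD_centralRep ρ 1)) :=
      IH _ (kerRep_commute _ (fun h w => (centralRep_centralMap hg 1 h w).symm) h1)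
        (kerRep_bijective _ (hST 1) (hTS 1) (hSd 1) h1)
    have hH : ∀ n, Acyclic
        (homologyRep (centralD_centralRep ρ (n + 1)) (centralD_centralRep ρ (n + 2))) := by
      intro n
      have hq : ∀ F : CentralCochain ρ (n + 2), centralD ρ (n + 2) F = 0 →
          centralRep ρ (n + 2) g F - centralMap hg (n + 2) F ∈
            LinearMap.range (centralD ρ (n + 1)) :=
        fun F hF => ⟨_, (hT (n + 1) F hF).symm⟩
      exact IH _
        (homologyRep_commute _ _ (fun h w => (centralRep_centralMap hg _ h w).symm) hq)
        (homologyRep_bijective _ _ (hST _) (hTS _) (hSd _)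
          (fun F => ⟨_, centralD_centralMap hS _ F⟩) hq)
    intro F hF hd
    obtain ⟨E, hE, hEF⟩ := exists_invariant_preimage (K := fun n => CentralCochain ρ (n + 1))
      (κ := fun n => centralRep ρ (n + 1)) (δ := fun n => centralD ρ (n + 1))
      (fun n => centralD_centralRep ρ (n + 1)) (fun n => centralD_centralD ρ (n + 1))
      (vanishes_centralRep ρ) h0 hH p (v := ⟨F, fun z => isEquivariant_iff.1 hF z⟩)
      (fun q => q.induction_on fun h => Subtype.ext (isEquivariant_iff.1 hF h)) (Subtype.ext hd)
    exact ⟨E.1, isEquivariant_iff.2 fun h => congrArg Subtype.val (hE h),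
      congrArg Subtype.val hEF⟩

/-- `g` need not be central in `G`, only act centrally; this is what survives in the induction. The
coefficients live in `Type (max v w)` so that spaces of cochains stay in the same universe. -/
theorem acyclic_of_bijective_sub {k : Type u} [CommRing k] (G : Type v) [Group G]
    [Group.IsNilpotent G] :
    ∀ {V : Type (max v w)} [AddCommGroup V] [Module k V] (ρ : Representation k G V) (g : G),
      (∀ h v, ρ g (ρ h v) = ρ h (ρ g v)) → (Function.Bijective fun v => ρ g v - v) →
      Acyclic ρ := by
  refine Group.nilpotent_center_quotient_ind (P := fun G _ _ => ∀ {V : Type (max v w)}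
    [AddCommGroup V] [Module k V] (ρ : Representation k G V) (g : G),
    (∀ h v, ρ g (ρ h v) = ρ h (ρ g v)) → (Function.Bijective fun v => ρ g v - v) →
    Acyclic ρ) G (fun G _ _ => ?_) (fun G _ _ IH => ?_)
  · intro V _ _ ρ g _ hu
    have hV : ∀ v : V, v = 0 := fun v => hu.1 (by simp [Subsingleton.elim g 1])
    refine ⟨fun v _ => hV v, fun p F _ _ => ⟨0, fun h x => ?_, funext fun x => ?_⟩⟩
    · rw [hV (ρ h _)]
      rfl
    · rw [hV (F x), hV (d k p 0 x)]
  · intro V _ _ ρ g hg hu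
    exact acyclic_of_quotient_center.{u, v, max v w} (fun σ => IH σ g) hg hu

end Nilpotent

end HomogeneousCochain

/-! ### Finite-dimensional representations of nilpotent groups -/

namespace HomogeneousCochain

open scoped commutatorElement

universe u v w

/-- Otherwise `ρ` is trivial on each term of the upper central series in turn: once commutators with
`x` act trivially, `ρ x` commutes with the action, hence is `1`. -/
theorem exists_commute_of_ne_one {k G V : Type*} [CommRing k] [Group G] [Group.IsNilpotent G]
    [AddCommGroup V] [Module k V] {ρ : Representation k G V} (hρ : ∃ g, ρ g ≠ 1) :
    ∃ g, ρ g ≠ 1 ∧ ∀ h v, ρ g (ρ h v) = ρ h (ρ g v) := by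
  by_contra! hc
  obtain ⟨g, hg⟩ := hρ
  obtain ⟨n, hn⟩ := Group.IsNilpotent.nilpotent G
  suffices ∀ n, ∀ x ∈ Subgroup.upperCentralSeries G n, ρ x = 1 from
    hg (this n g (hn ▸ Subgroup.mem_top g))
  intro n
  induction n with
  | zero =>
    intro x hx
    rw [Subgroup.upperCentralSeries_zero, Subgroup.mem_bot] at hx
    rw [hx, map_one]
  | succ n ih =>
    intro x hx
    by_contra hx1
    obtain ⟨h, v, hv⟩ := hc x hx1
    apply hv
    have := ih _ (Subgroup.mem_upperCentralSeries_succ_iff.1 hx h)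
    rw [← Module.End.mul_apply, ← map_mul, ← Module.End.mul_apply, ← map_mul,
      show x * h = ⁅x, h⁆ * (h * x) by rw [commutatorElement_def]; group, map_mul, this, one_mul]

theorem commute_sub_one {k G V : Type*} [CommRing k] [Group G] [AddCommGroup V] [Module k V]
    {ρ : Representation k G V} {g : G} (hg : ∀ h v, ρ g (ρ h v) = ρ h (ρ g v)) (h : G) (v : V) :
    (ρ g - 1 : Module.End k V) (ρ h v) = ρ h ((ρ g - 1 : Module.End k V) v) := by
  simp [hg]

theorem coe_subrepresentation_sub_one_pow {k G V : Type*} [CommRing k] [Group G] [AddCommGroup V]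
    [Module k V] (ρ : Representation k G V) (W : Submodule k V) (hW : ∀ g, W ≤ W.comap (ρ g))
    (g : G) (n : ℕ) (w : W) :
    (((ρ.subrepresentation W hW g - 1 : Module.End k W) ^ n) w : V) =
      ((ρ g - 1 : Module.End k V) ^ n) w := by
  induction n with
  | zero => rfl
  | succ n ih =>
    rw [pow_succ', pow_succ', Module.End.mul_apply, Module.End.mul_apply, ← ih]
    rfl

variable {k : Type u} {G : Type v} [Field k] [Group G] [Group.IsNilpotent G]

theorem acyclic_of_invariants_eq_zero_of_large {V : Type (max v w)} [AddCommGroup V] [Module k V]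
    [FiniteDimensional k V] (ρ : Representation k G V) (hρ : ∀ v, (∀ g, ρ g v = v) → v = 0) :
    Acyclic ρ := by
  induction hn : Module.finrank k V using Nat.strong_induction_on generalizing V with
  | _ n ih =>
    subst hn
    refine ⟨hρ, ?_⟩
    by_cases h1 : ∃ g, ρ g ≠ 1
    swap
    · push Not at h1
      have hV : ∀ v : V, v = 0 := fun v => hρ v fun g => by rw [h1]; rfl
      exact fun p F _ _ => ⟨0, fun h x => (hV _).trans (hV _).symm,
        funext fun x => (hV _).trans (hV _).symm⟩
    obtain ⟨g, hg1, hg⟩ := exists_commute_of_ne_one h1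
    by_cases hinj : Function.Injective (ρ g - 1 : Module.End k V)
    · exact (acyclic_of_bijective_sub.{u, v, w} G ρ g hg
        ⟨hinj, LinearMap.injective_iff_surjective.1 hinj⟩).2
    let W := LinearMap.ker (ρ g - 1 : Module.End k V)
    have hW := commute_sub_one hg
    have hlt : Module.finrank k W < Module.finrank k V := Submodule.finrank_lt fun htop =>
      hg1 (sub_eq_zero.1 (LinearMap.ker_eq_top.1 htop))
    have hlt' : Module.finrank k (V ⧸ W) < Module.finrank k V := by
      have h1 := W.finrank_quotient_add_finrank
      have h2 : Module.finrank k W ≠ 0 := fun h =>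
        hinj (LinearMap.ker_eq_bot.1 (Submodule.finrank_eq_zero.1 h))
      omega
    let σ : Representation k G W := kerRep hW
    let τ : Representation k G (V ⧸ W) := ρ.quotient W fun h v hv => by
      rw [Submodule.mem_comap, LinearMap.mem_ker, hW, LinearMap.mem_ker.1 hv, map_zero]
    have hex : LinearMap.range W.subtype = LinearMap.ker W.mkQ := by
      rw [Submodule.range_subtype, Submodule.ker_mkQ]
    have hσ : Acyclic σ := ih _ hlt σ (fun w hw => Subtype.ext
      (hρ w fun h => congrArg Subtype.val (hw h))) rfl
    -- Invariants of the quotient lift to `V`, since `W` has no first cohomology, and there they are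
    -- zero.
    have hτ : Acyclic τ := ih _ hlt' τ (fun y hy => by
      obtain ⟨v, hv, rfl⟩ := Vanishes.exists_invariant_lift (ρ := σ) (σ := ρ) (τ := τ)
        (i := W.subtype) (f := W.mkQ) (fun _ _ => rfl) (fun _ _ => rfl)
        W.subtype_injective W.mkQ_surjective hex (hσ.2 1) hy
      rw [hρ v hv, map_zero]) rfl
    exact fun p => Vanishes.extension (ρ := σ) (σ := ρ) (τ := τ)
        (i := W.subtype) (f := W.mkQ) (fun _ _ => rfl) (fun _ _ => rfl)
        W.subtype_injective W.mkQ_surjective hex (hσ.2 p) (hτ.2 p)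

/-- A finite-dimensional representation of a nilpotent group without nonzero invariants is
acyclic. -/
theorem acyclic_of_invariants_eq_zero {V : Type w} [AddCommGroup V] [Module k V]
    [FiniteDimensional k V] (ρ : Representation k G V) (hρ : ∀ v, (∀ g, ρ g v = v) → v = 0) :
    Acyclic ρ := by
  let e : ULift.{v} V ≃ₗ[k] V := ULift.moduleEquiv
  let ρ' : Representation k G (ULift.{v} V) := MonoidHom.comp e.symm.conjRingEquiv ρ
  have he : ∀ g v, e (ρ' g v) = ρ g (e v) := fun _ _ => rfl
  refine ⟨hρ, fun p =>
    ((acyclic_of_invariants_eq_zero_of_large.{u, v, w} ρ' fun v hv => ?_).2 p).of_equiv e he⟩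
  rw [← e.map_eq_zero_iff]
  exact hρ _ fun g => by rw [← he, hv]

/-- A unipotent representation of a nilpotent group on a nonzero finite-dimensional space has a
nonzero invariant vector. -/
theorem exists_invariant_of_isNilpotent {V : Type w} [AddCommGroup V] [Module k V]
    [FiniteDimensional k V] [Nontrivial V] (ρ : Representation k G V)
    (hρ : ∀ g, IsNilpotent (ρ g - 1)) : ∃ v ≠ 0, ∀ g, ρ g v = v := by
  induction hn : Module.finrank k V using Nat.strong_induction_on generalizing V with
  | _ n ih =>
    subst hn
    by_cases h1 : ∃ g, ρ g ≠ 1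
    swap
    · push Not at h1
      obtain ⟨v, hv⟩ := exists_ne (0 : V)
      exact ⟨v, hv, fun g => by rw [h1]; rfl⟩
    obtain ⟨g, hg1, hg⟩ := exists_commute_of_ne_one h1
    let W := LinearMap.ker (ρ g - 1 : Module.End k V)
    have hW := commute_sub_one hg
    have hlt : Module.finrank k W < Module.finrank k V := Submodule.finrank_lt fun htop =>
      hg1 (sub_eq_zero.1 (LinearMap.ker_eq_top.1 htop))
    have : Nontrivial W := by
      refine Submodule.nontrivial_iff_ne_bot.2 fun hbot => ?_
      have hu : IsUnit (ρ g - 1 : Module.End k V) := (LinearMap.isUnit_iff_ker_eq_bot _).2 hbot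
      obtain ⟨n, hn⟩ := hρ g
      exact not_isUnit_zero (hn ▸ hu.pow n)
    obtain ⟨w, hw, hwg⟩ := ih _ hlt (kerRep hW : Representation k G W) (fun h => by
      obtain ⟨n, hn⟩ := hρ h
      refine ⟨n, LinearMap.ext fun w => Subtype.ext ?_⟩
      refine (coe_subrepresentation_sub_one_pow _ _ _ h n w).trans ?_
      rw [hn]
      rfl) rfl
    exact ⟨w, fun h => hw (Subtype.ext h), fun g => congrArg Subtype.val (hwg g)⟩

end HomogeneousCochain

/-! ### From Hochschild cochains to the adjoint representation -/

namespace GroupBimodule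

open HomogeneousCochain

section

variable {k G M : Type*} [CommRing k] [Group G] [AddCommGroup M] [Module k M]

/-- The adjoint action `m ↦ g · m · g⁻¹`. -/
def adjoint (B : GroupBimodule k G M) : Representation k G M where
  toFun g := B.left g * B.right (op g⁻¹)
  map_one' := by simp
  map_mul' g h := by
    ext m
    simp only [map_mul, mul_inv_rev, op_mul, Module.End.mul_apply, B.left_right]

theorem adjoint_apply (B : GroupBimodule k G M) (g : G) (m : M) :
    B.adjoint g m = B.left g (B.right (op g⁻¹) m) :=
  rfl

theorem isEquivariant_homogenize (B : GroupBimodule k G M) (n : ℕ) (f : (Fin n → G) → M) :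
    IsEquivariant B.adjoint (B.homogenize n f) := by
  intro h x
  simp only [homogenize, adjoint_apply, Pi.smul_apply, smul_eq_mul, map_mul, mul_inv_rev, op_mul,
    Module.End.mul_apply, B.left_right, mul_assoc, inv_mul_cancel_left]

theorem exists_homogenize_eq (B : GroupBimodule k G M) (n : ℕ) {E : (Fin (n + 1) → G) → M}
    (hE : IsEquivariant B.adjoint E) : ∃ e, B.homogenize n e = E := by
  -- Restrict `E` to tuples starting at `1`, given by partial products, and undo the right twist by
  -- the last entry.
  refine ⟨fun y => B.right (op (Fin.partialProd y (Fin.last n))) (E (Fin.partialProd y)), ?_⟩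
  funext x
  have hx : Fin.partialProd (fun i : Fin n => (x i.castSucc)⁻¹ * x i.succ) = (x 0)⁻¹ • x := by
    conv_rhs => rw [← Fin.partialProd_left_inv x]
    funext i
    simp
  have hl : ((x 0)⁻¹ • x) (Fin.last n) = (x 0)⁻¹ * x (Fin.last n) := rfl
  rw [homogenize, hx, hl, ← Module.End.mul_apply (B.right _), ← map_mul, ← op_mul,
    mul_assoc, mul_inv_cancel, mul_one, ← adjoint_apply, ← hE, smul_inv_smul]

theorem hochschildComplex_d (B : GroupBimodule k G M) (n : ℕ) :
    B.hochschildComplex.d n (n + 1) = ModuleCat.ofHom (B.hochschildD n) :=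
  CochainComplex.of_d (fun n => ModuleCat.of k ((Fin n → G) → M))
    (fun n => ModuleCat.ofHom (B.hochschildD n)) n

theorem homogenize_hochschildD_eq_d (B : GroupBimodule k G M) (n : ℕ) (f : (Fin n → G) → M) :
    B.homogenize (n + 1) (B.hochschildD n f) = d k (n + 1) (B.homogenize n f) :=
  funext fun x => B.homogenize_hochschildD n f x

theorem homogenize_zero (B : GroupBimodule k G M) (n : ℕ) : B.homogenize n 0 = 0 := by
  funext x
  simp [homogenize]

theorem eq_zero_of_hochschildD_eq_zero (B : GroupBimodule k G M) (hB : Acyclic B.adjoint)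
    (f : (Fin 0 → G) → M) (hf : B.hochschildD 0 f = 0) : f = 0 := by
  apply B.homogenize_injective
  rw [homogenize_zero]
  exact hB.eq_zero (B.isEquivariant_homogenize 0 f)
    (by rw [← homogenize_hochschildD_eq_d, hf, homogenize_zero])

theorem exists_hochschildD_eq (B : GroupBimodule k G M) (hB : Acyclic B.adjoint) (n : ℕ)
    (f : (Fin (n + 1) → G) → M) (hf : B.hochschildD (n + 1) f = 0) :
    ∃ e, B.hochschildD n e = f := by
  obtain ⟨E, hE, hEf⟩ := hB.2 (n + 1) _ (B.isEquivariant_homogenize (n + 1) f)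
    (by rw [← homogenize_hochschildD_eq_d, hf, homogenize_zero])
  obtain ⟨e, rfl⟩ := B.exists_homogenize_eq n hE
  exact ⟨e, B.homogenize_injective (n + 1) ((B.homogenize_hochschildD_eq_d n e).trans hEf)⟩

theorem isZero_HH_of_acyclic (B : GroupBimodule k G M) (hB : Acyclic B.adjoint) (n : ℕ) :
    Limits.IsZero (B.HH n) := by
  apply HomologicalComplex.ExactAt.isZero_homology
  cases n with
  | zero =>
    rw [HomologicalComplex.exactAt_iff' _ 0 0 1 (by simp) (by simp),
      ShortComplex.moduleCat_exact_iff]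
    intro f hf
    have hf : (B.hochschildComplex.d 0 1).hom f = 0 := hf
    rw [hochschildComplex_d] at hf
    exact ⟨0, (map_zero _).trans (B.eq_zero_of_hochschildD_eq_zero hB f hf).symm⟩
  | succ n =>
    rw [HomologicalComplex.exactAt_iff' _ n (n + 1) (n + 2) (by simp) (by simp),
      ShortComplex.moduleCat_exact_iff]
    intro f hf
    have hf : (B.hochschildComplex.d (n + 1) (n + 2)).hom f = 0 := hf
    rw [hochschildComplex_d] at hf
    obtain ⟨e, he⟩ := B.exists_hochschildD_eq hB n f hf
    refine ⟨e, ?_⟩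
    change (B.hochschildComplex.d n (n + 1)).hom e = f
    rw [hochschildComplex_d]
    exact he

theorem adjoint_invariants (B : GroupBimodule k G M) {m : M} (hm : ∀ g, B.adjoint g m = m) (g : G) :
    B.left g m = B.right (op g) m := by
  conv_rhs => rw [← hm g]
  rw [adjoint_apply, ← B.left_right, ← Module.End.mul_apply (B.right _), ← map_mul, ← op_mul]
  simp

end

theorem adjoint_invariants_eq_zero {k G M : Type*} [Field k] [Group G] [Group.IsNilpotent G]
    [AddCommGroup M] [Module k M] [FiniteDimensional k M] (B : GroupBimodule k G M)
    (hright : ∀ g : G, IsNilpotent (B.right (op g) - 1))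
    (hleft : ∀ m : M, (∀ g : G, B.left g m = m) → m = 0) (m : M)
    (hm : ∀ g, B.adjoint g m = m) : m = 0 := by
  by_contra hm0
  have hlr := B.adjoint_invariants hm
  let U : Submodule k M := Submodule.span k (Set.range fun h : G => B.right (op h) m)
  have hU : ∀ g, U ≤ U.comap (B.left g) := by
    intro g
    refine Submodule.span_le.2 ?_
    rintro _ ⟨h, rfl⟩
    change B.left g (B.right (op h) m) ∈ U
    rw [B.left_right, hlr, ← Module.End.mul_apply, ← map_mul, ← op_mul]
    exact Submodule.subset_span ⟨_, rfl⟩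
  have hmU : m ∈ U := Submodule.subset_span ⟨1, by simp⟩
  -- The two operators agree on `m` and commute, so all their powers agree on `m`; unipotence on the
  -- right thus kills `m` on the left.
  have hpow : ∀ (g : G) (n : ℕ), ((B.left g - 1 : Module.End k M) ^ n) m =
      ((B.right (op g) - 1 : Module.End k M) ^ n) m := by
    intro g n
    have hc : Commute (B.left g - 1 : Module.End k M) (B.right (op g) - 1) :=
      Commute.sub_left (Commute.sub_right (LinearMap.ext fun x => B.left_right g g x)
        (Commute.one_right _)) (Commute.one_left _)
    induction n with
    | zero => rfl
    | succ n ih =>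
      rw [pow_succ', Module.End.mul_apply, ih, ← Module.End.mul_apply, (hc.pow_right n).eq,
        Module.End.mul_apply, LinearMap.sub_apply, hlr, pow_succ, Module.End.mul_apply]
      rfl
  have : Nontrivial U := Submodule.nontrivial_iff_ne_bot.2 fun h =>
    hm0 ((Submodule.mem_bot k).1 (h ▸ hmU))
  obtain ⟨u, hu, hug⟩ := exists_invariant_of_isNilpotent (B.left.subrepresentation U hU) fun g => by
    obtain ⟨n, hn⟩ := hright g
    refine ⟨n, LinearMap.ext fun u => Subtype.ext ?_⟩
    refine (coe_subrepresentation_sub_one_pow _ _ _ g n u).trans ?_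
    -- The left operator commutes with the right action, so vanishing at `m` spreads to the
    -- generators `m · h`.
    have h2 : U ≤ LinearMap.ker ((B.left g - 1 : Module.End k M) ^ n) := by
      refine Submodule.span_le.2 ?_
      rintro _ ⟨h, rfl⟩
      have hc : Commute ((B.left g - 1 : Module.End k M) ^ n) (B.right (op h)) :=
        Commute.pow_left (Commute.sub_left (LinearMap.ext fun x => B.left_right g h x)
          (Commute.one_left _)) n
      change ((B.left g - 1 : Module.End k M) ^ n) (B.right (op h) m) = 0
      rw [← Module.End.mul_apply, hc.eq, Module.End.mul_apply, hpow, hn, LinearMap.zero_apply,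
        map_zero]
    exact h2 u.2
  exact hu (Subtype.ext (hleft u fun g => congrArg Subtype.val (hug g)))

end GroupBimodule

theorem mainTheorem8 {k G M : Type*} [Field k] [Group G] [Group.IsNilpotent G]
    [AddCommGroup M] [Module k M] [FiniteDimensional k M] (B : GroupBimodule k G M)
    (hright : ∀ g : G, IsNilpotent (B.right (op g) - 1))
    (hleft : ∀ m : M, (∀ g : G, B.left g m = m) → m = 0) :
    ∀ n : ℕ, Limits.IsZero (B.HH n) := by
  refine B.isZero_HH_of_acyclic ?_
  exact HomogeneousCochain.acyclic_of_invariants_eq_zero _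
    (B.adjoint_invariants_eq_zero hright hleft)
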